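/- Let $M,N\in\mathbb R$ with $-M<N$, let $a,b$ be real functions, continuous on $[-M,N]$, with $a>0$ on $[-M,N]$, and fix $\theta\in(-M,N)$. Put $C(x)=\int_\theta^x \frac{b}{a}$ and let $\mu(dx)=\frac{e^{C(x)}}{a(x)}\,dx$, $\nu(dx)=e^{C(x)}\,dx$, $\hat\nu(dx)=e^{-C(x)}\,dx$ on $(-M,N)$; let $\pi=\mu/\mu(-M,N)$ and $\pi(f)=\int f\,d\pi$. These are the measures associated with the operator $L=a(x)\frac{d^2}{dx^2}+b(x)\frac{d}{dx}=\frac{d}{d\mu}\frac{d}{d\hat\nu}$. Let $A$ be the optimal (smallest) constant in the Poincaré inequality $$\|f-\pi(f)\|_{L^2(\mu)}\le A\,\|f'\|_{L^2(\nu)}$$ for all $f\in L^2(\mu)$ that are locally absolutely continuous on $(-M,N)$ (the right-hand side may be infinite), and let $$\lambda_1=\inf\big\{\|f'\|_{L^2(\nu)}^2:\ \pi(f)=0,\ \|f\|_{L^2(\mu)}=1\big\}$$ over the same functions $f$ (the variational form of the first nontrivial Neumann eigenvalue of $L$). Let $$\mathscr F=\{f\in C^1[-M,N]\cap C^2(-M,N):\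 f(-M)=f(N)=0,\ f>0\text{ on }(-M,N)\},$$ and define $$\lambda_S=\sup_{f\in\mathscr F}\ \inf_{x\in(-M,N)}\frac{-L_Sf}{f}(x),\qquad \lambda_0^*=\sup_{f\in\mathscr F}\ \inf_{x\in(-M,N)}\frac{-L^*f}{f}(x)$$ (as extended real numbers), where $L_S=a\frac{d^2}{dx^2}+(a'+b)\frac{d}{dx}+b'$ is the associated Schrödinger operator and $L^*=\frac{d}{d\hat\nu}\frac{d}{d\mu}=a\frac{d^2}{dx^2}+(a'-b)\frac{d}{dx}$ is the dual operator. Here $\frac{df}{dm}=f'/\rho$ for a measure $m(dx)=\rho(x)\,dx$. Then $0<A<\infty$ and $A^{-2}=\lambda_1$. If $a\in C^1(-M,N)$, then $\lambda_1=\lambda_0^*$. If $a,b\in C^1(-M,N)$, then $\lambda_1=\lambda_S$. In particular, if $a,b\in C^1(-M,N)$, then $$A^{-2}=\lambda_1=\lambda_S=\lambda_0^*.$$ -/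

import Mathlib

open MeasureTheory Set
open scoped ENNReal

noncomputable section

namespace HardyLinear

/-- `C(x) = ∫_θ^x b/a`. -/
def potential (a b : ℝ → ℝ) (θ x : ℝ) : ℝ := ∫ t in θ..x, b t / a t

/-- The density `e^C / a` of `μ` with respect to Lebesgue measure. -/
def muDensity (a b : ℝ → ℝ) (θ x : ℝ) : ℝ := Real.exp (potential a b θ x) / a x

/-- The density `e^C` of `ν` with respect to Lebesgue measure. -/
def nuDensity (a b : ℝ → ℝ) (θ x : ℝ) : ℝ := Real.exp (potential a b θ x)

/-- The density `e^{-C}` of `ν̂` with respect to Lebesgue measure. -/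
def nuHatDensity (a b : ℝ → ℝ) (θ x : ℝ) : ℝ := Real.exp (-potential a b θ x)

/-- The measure `μ(dx) = (e^C / a) dx` on `(-M, N)`. -/
def mu (M N : ℝ) (a b : ℝ → ℝ) (θ : ℝ) : Measure ℝ :=
  (volume.restrict (Ioo (-M) N)).withDensity fun x => ENNReal.ofReal (muDensity a b θ x)

/-- The measure `ν(dx) = e^C dx` on `(-M, N)`. -/
def nu (M N : ℝ) (a b : ℝ → ℝ) (θ : ℝ) : Measure ℝ :=
  (volume.restrict (Ioo (-M) N)).withDensity fun x => ENNReal.ofReal (nuDensity a b θ x)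

/-- The normalization `π` of `μ`. -/
def piMeasure (M N : ℝ) (a b : ℝ → ℝ) (θ : ℝ) : Measure ℝ :=
  (mu M N a b θ univ)⁻¹ • mu M N a b θ

/-- The functions admitted in the Poincaré inequality: (locally) absolutely continuous on
`(-M, N)` and in `L²(μ)`. -/
def Admissible (M N : ℝ) (a b : ℝ → ℝ) (θ : ℝ) (f : ℝ → ℝ) : Prop :=
  (∀ x y : ℝ, -M < x → x ≤ y → y < N → AbsolutelyContinuousOnInterval f x y) ∧
    MemLp f 2 (mu M N a b θ)

/-- The optimal constant `A` in `‖f - π(f)‖_{L²(μ)} ≤ A ‖f'‖_{L²(ν)}`. -/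
def optimalConst (M N : ℝ) (a b : ℝ → ℝ) (θ : ℝ) : ℝ≥0∞ :=
  sInf {A : ℝ≥0∞ | ∀ f : ℝ → ℝ, Admissible M N a b θ f →
    eLpNorm (fun x => f x - ∫ y, f y ∂(piMeasure M N a b θ)) 2 (mu M N a b θ) ≤
      A * eLpNorm (deriv f) 2 (nu M N a b θ)}

/-- `λ₁ = inf {‖f'‖²_{L²(ν)} : π(f) = 0, ‖f‖_{L²(μ)} = 1}`. -/
def lambdaOne (M N : ℝ) (a b : ℝ → ℝ) (θ : ℝ) : ℝ≥0∞ :=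
  sInf {r : ℝ≥0∞ | ∃ f : ℝ → ℝ, Admissible M N a b θ f ∧
    (∫ y, f y ∂(piMeasure M N a b θ)) = 0 ∧ eLpNorm f 2 (mu M N a b θ) = 1 ∧
      r = eLpNorm (deriv f) 2 (nu M N a b θ) ^ 2}

/-- `L_S f = a f'' + (a' + b) f' + b' f`. -/
def opLS (a b f : ℝ → ℝ) (x : ℝ) : ℝ :=
  a x * deriv (deriv f) x + (deriv a x + b x) * deriv f x + deriv b x * f x

/-- The derivative `df/dm = f' / ρ` with respect to the measure `m(dx) = ρ(x) dx`. -/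
def derivWrt (ρ f : ℝ → ℝ) (x : ℝ) : ℝ := deriv f x / ρ x

/-- The dual operator `L* = d/dν̂ d/dμ`. -/
def opDual (a b : ℝ → ℝ) (θ : ℝ) (f : ℝ → ℝ) (x : ℝ) : ℝ :=
  derivWrt (nuHatDensity a b θ) (derivWrt (muDensity a b θ) f) x

/-- The class `𝓕` of functions in `C¹[-M, N] ∩ C²(-M, N)` that vanish at `-M` and `N` and are
positive on `(-M, N)`. -/
def testClass (M N : ℝ) : Set (ℝ → ℝ) :=
  {f | ContDiffOn ℝ 1 f (Icc (-M) N) ∧ ContDiffOn ℝ 2 f (Ioo (-M) N) ∧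
    f (-M) = 0 ∧ f N = 0 ∧ ∀ x ∈ Ioo (-M) N, 0 < f x}

/-- The principal Dirichlet eigenvalue
`sup_{f ∈ 𝓕} inf_{x ∈ (-M, N)} (-T f / f)(x)` of an operator `T`, as an extended real. -/
def principalEigenvalue (M N : ℝ) (T : (ℝ → ℝ) → ℝ → ℝ) : EReal :=
  ⨆ f ∈ testClass M N, ⨅ x ∈ Ioo (-M) N, ((-T f x / f x : ℝ) : EReal)

/-- `λ_S`, the principal Dirichlet eigenvalue of `L_S`. -/
def lambdaS (M N : ℝ) (a b : ℝ → ℝ) : EReal := principalEigenvalue M N (opLS a b)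

/-- `λ₀*`, the principal Dirichlet eigenvalue of `L*`. -/
def lambdaDual (M N : ℝ) (a b : ℝ → ℝ) (θ : ℝ) : EReal :=
  principalEigenvalue M N (opDual a b θ)

end HardyLinear

end

/-! Write `ρ` and `σ` for the densities of `μ` and `ν̂`; then `1/σ` is the density of `ν`.
Everything is read off one pair `(f, w)` with `f' = ρ w`, `w' = -λ σ f`, `f = 0` at both ends and `f
> 0` inside. Here `f` is the principal Dirichlet eigenfunction of `L*`, and `w` is a Neumann
eigenfunction of `L` with the same eigenvalue, since the flux `w'/σ = -λ f` vanishes at the ends.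
The pair comes from a Prüfer shooting argument (`exists_dirichlet_eigenpair`), which needs only
continuous coefficients.

The Poincaré inequality with constant `λ⁻¹` for the squared norms follows without spectral theory.
Let `x₀` be the zero of `w`. Cauchy–Schwarz with weight `|w'|` bounds `|g x - g x₀|²` by `|w x|`
times the integral of `g'²/|w'|` between `x₀` and `x`. Integrating against `ρ` and exchanging the
integrals produces the tail mass of `ρ |w| = |f'|`, which telescopes to `f`, and `f/|w'| = 1/(λ σ)`
(`lintegral_sub_sq_le`). Replacing `g x₀` by the mean only lowers the left side. The function `w`
has mean zero and gives equality, so both `A⁻²` and `λ₁` equal `λ`.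

For `L*`, a Wronskian of `f` with any test function vanishes at both ends, and Rolle's theorem
yields a point where `-L* g / g = λ`; `f` itself has constant quotient `λ` (`lambdaDual_eq`).
Conjugation by `e^C` carries `L_S` to `L*` (`opDual_exp_mul`). -/

namespace HardyLinear

noncomputable section

/-! ### Prüfer phase and construction of the Dirichlet eigenpair -/

/-- The phase field `ρ cos² y + σ sin² y` of the Prüfer transform of `f' = ρ w`, `w' = -σ f`. -/
def phaseField (ρ σ : ℝ → ℝ) (t y : ℝ) : ℝ := ρ t * Real.cos y ^ 2 + σ t * Real.sin y ^ 2

theorem hasDerivAt_phaseField (ρ σ : ℝ → ℝ) (t y : ℝ) :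
    HasDerivAt (phaseField ρ σ t) ((σ t - ρ t) * (2 * Real.sin y * Real.cos y)) y := by
  have h := (((Real.hasDerivAt_cos y).pow 2).const_mul (ρ t)).add
    (((Real.hasDerivAt_sin y).pow 2).const_mul (σ t))
  refine h.congr_deriv ?_
  simp
  ring

theorem abs_two_sin_mul_cos_le (y : ℝ) : |2 * Real.sin y * Real.cos y| ≤ 1 := by
  rw [← Real.sin_two_mul]
  exact Real.abs_sin_le_one _

theorem phaseField_le {ρ σ : ℝ → ℝ} {t B : ℝ} (hρ : ρ t ≤ B) (hσ : σ t ≤ B) (y : ℝ) :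
    phaseField ρ σ t y ≤ B := by
  have hB : B = B * Real.cos y ^ 2 + B * Real.sin y ^ 2 := by
    linear_combination -B * Real.sin_sq_add_cos_sq y
  rw [hB, phaseField]
  gcongr

theorem le_phaseField {ρ σ : ℝ → ℝ} {t m : ℝ} (hρ : m ≤ ρ t) (hσ : m ≤ σ t) (y : ℝ) :
    m ≤ phaseField ρ σ t y := by
  have hm : m = m * Real.cos y ^ 2 + m * Real.sin y ^ 2 := by
    linear_combination -m * Real.sin_sq_add_cos_sq y
  rw [hm, phaseField]
  gcongr

/-- The `y`-derivative is `κ (σ - ρ) sin 2y`, and `|σ - ρ| ≤ B` because both values lie in `[0, B]`.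
-/
theorem lipschitzWith_phaseField {ρ σ : ℝ → ℝ} {t B : ℝ} (hρ₀ : 0 ≤ ρ t) (hσ₀ : 0 ≤ σ t)
    (hρ : ρ t ≤ B) (hσ : σ t ≤ B) (κ : ℝ) :
    LipschitzWith (Real.toNNReal (|κ| * B)) (fun y => κ * phaseField ρ σ t y) := by
  have hd : ∀ y, HasDerivAt (fun y => κ * phaseField ρ σ t y)
      (κ * ((σ t - ρ t) * (2 * Real.sin y * Real.cos y))) y :=
    fun y => (hasDerivAt_phaseField ρ σ t y).const_mul κ
  refine lipschitzWith_of_nnnorm_deriv_le (fun y => (hd y).differentiableAt) fun y => ?_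
  rw [(hd y).deriv, ← NNReal.coe_le_coe, coe_nnnorm, Real.norm_eq_abs, abs_mul, abs_mul]
  refine le_trans ?_ (Real.le_coe_toNNReal _)
  refine mul_le_mul_of_nonneg_left ?_ (abs_nonneg _)
  have h1 : |σ t - ρ t| ≤ B := abs_le.2 ⟨by linarith, by linarith⟩
  nlinarith [abs_two_sin_mul_cos_le y, abs_nonneg (σ t - ρ t)]

/-- Global solvability of the phase equation `θ' = κ (ρ cos² θ + σ sin² θ)`. -/
theorem exists_phase {p q : ℝ} (hpq : p ≤ q) {ρ σ : ℝ → ℝ} (hρ : Continuous ρ)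
    (hσ : Continuous σ) (hρ₀ : ∀ x, 0 < ρ x) (hσ₀ : ∀ x, 0 < σ x) (κ : ℝ) :
    ∃ φ : ℝ → ℝ, φ p = 0 ∧ ∀ t ∈ Icc p q, HasDerivAt φ (κ * phaseField ρ σ t (φ t)) t := by
  -- The interval is widened by `1` on each side so that the solution has two-sided derivatives at
  -- `p` and `q`.
  obtain ⟨B₁, hB₁⟩ := (isCompact_Icc (a := p - 1) (b := q + 1)).bddAbove_image hρ.continuousOn
  obtain ⟨B₂, hB₂⟩ := (isCompact_Icc (a := p - 1) (b := q + 1)).bddAbove_image hσ.continuousOn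
  set B := max B₁ B₂
  have hρB : ∀ t ∈ Icc (p - 1) (q + 1), ρ t ≤ B := fun t ht =>
    (hB₁ (mem_image_of_mem _ ht)).trans (le_max_left _ _)
  have hσB : ∀ t ∈ Icc (p - 1) (q + 1), σ t ≤ B := fun t ht =>
    (hB₂ (mem_image_of_mem _ ht)).trans (le_max_right _ _)
  have hp : p ∈ Icc (p - 1) (q + 1) := ⟨by linarith, by linarith⟩
  have hB : 0 ≤ B := (hρ₀ p).le.trans (hρB p hp)
  -- The field is bounded by `|κ| B` for every `y`, so the ball can be given exactly the radius
  -- "bound times time" and a single application covers the whole interval.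
  have hPL : IsPicardLindelof (fun t y => κ * phaseField ρ σ t y)
      (tmin := p - 1) (tmax := q + 1) ⟨p, hp⟩ (0 : ℝ)
      (Real.toNNReal (|κ| * B) * Real.toNNReal (max (q + 1 - p) (p - (p - 1)))) 0
      (Real.toNNReal (|κ| * B)) (Real.toNNReal (|κ| * B)) := by
    refine ⟨fun t ht => ?_, fun y _ => ?_, fun t ht y _ => ?_, ?_⟩
    · exact (lipschitzWith_phaseField (hρ₀ t).le (hσ₀ t).le (hρB t ht) (hσB t ht) κ).lipschitzOnWith
    · unfold phaseField
      fun_prop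
    · refine le_trans ?_ (Real.le_coe_toNNReal _)
      rw [Real.norm_eq_abs, abs_mul]
      refine mul_le_mul_of_nonneg_left ?_ (abs_nonneg _)
      rw [abs_of_nonneg (le_phaseField (hρ₀ t).le (hσ₀ t).le y)]
      exact phaseField_le (hρB t ht) (hσB t ht) y
    · have : 0 ≤ max (q + 1 - p) (p - (p - 1)) := le_max_of_le_right (by linarith)
      simp only [NNReal.coe_mul, NNReal.coe_zero, sub_zero]
      rw [Real.coe_toNNReal _ this]
  obtain ⟨φ, h0, hφ⟩ := hPL.exists_eq_forall_mem_Icc_hasDerivWithinAt₀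
  refine ⟨φ, h0, fun t ht => (hφ t ⟨by linarith [ht.1], by linarith [ht.2]⟩).hasDerivAt ?_⟩
  exact Icc_mem_nhds (by linarith [ht.1]) (by linarith [ht.2])

/-- Continuous dependence of the phase on the parameter. -/
theorem continuous_phase_end {p q : ℝ} (hpq : p ≤ q) {ρ σ : ℝ → ℝ} (hρ : Continuous ρ)
    (hσ : Continuous σ) (hρ₀ : ∀ x, 0 < ρ x) (hσ₀ : ∀ x, 0 < σ x) {φ : ℝ → ℝ → ℝ}
    (h0 : ∀ κ, φ κ p = 0)
    (hφ : ∀ κ, ∀ t ∈ Icc p q, HasDerivAt (φ κ) (κ * phaseField ρ σ t (φ κ t)) t) :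
    Continuous fun κ => φ κ q := by
  obtain ⟨B₁, hB₁⟩ := (isCompact_Icc (a := p) (b := q)).bddAbove_image hρ.continuousOn
  obtain ⟨B₂, hB₂⟩ := (isCompact_Icc (a := p) (b := q)).bddAbove_image hσ.continuousOn
  set B := max B₁ B₂
  have hρB : ∀ t ∈ Icc p q, ρ t ≤ B := fun t ht =>
    (hB₁ (mem_image_of_mem _ ht)).trans (le_max_left _ _)
  have hσB : ∀ t ∈ Icc p q, σ t ≤ B := fun t ht =>
    (hB₂ (mem_image_of_mem _ ht)).trans (le_max_right _ _)
  refine continuous_iff_continuousAt.2 fun κ => ?_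
  -- The phase for `κ'` solves the equation for `κ` up to an error `|κ' - κ| B`; Grönwall's
  -- inequality turns this into a distance bound.
  have key : ∀ κ', dist (φ κ' q) (φ κ q) ≤
      gronwallBound 0 (Real.toNNReal (|κ| * B)) (|κ' - κ| * B) (q - p) := by
    intro κ'
    have := dist_le_of_approx_trajectories_ODE_of_mem
      (v := fun t y => κ * phaseField ρ σ t y) (s := fun _ => univ)
      (K := Real.toNNReal (|κ| * B)) (f := φ κ') (g := φ κ) (a := p) (b := q)
      (f' := fun t => κ' * phaseField ρ σ t (φ κ' t)) (g' := fun t => κ * phaseField ρ σ t (φ κ t))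
      (εf := |κ' - κ| * B) (εg := 0) (δ := 0)
      (fun t ht => (lipschitzWith_phaseField (hρ₀ t).le (hσ₀ t).le (hρB t (Ico_subset_Icc_self ht))
        (hσB t (Ico_subset_Icc_self ht)) κ).lipschitzOnWith)
      (fun t ht => (hφ κ' t ht).continuousAt.continuousWithinAt)
      (fun t ht => (hφ κ' t (Ico_subset_Icc_self ht)).hasDerivWithinAt)
      (fun t ht => ?_) (fun _ _ => mem_univ _)
      (fun t ht => (hφ κ t ht).continuousAt.continuousWithinAt)
      (fun t ht => (hφ κ t (Ico_subset_Icc_self ht)).hasDerivWithinAt)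
      (fun t ht => by simp) (fun _ _ => mem_univ _) (by simp [h0]) q ⟨hpq, le_rfl⟩
    · simpa using this
    · rw [Real.dist_eq, ← sub_mul, abs_mul]
      refine mul_le_mul_of_nonneg_left ?_ (abs_nonneg _)
      rw [abs_of_nonneg (le_phaseField (hρ₀ t).le (hσ₀ t).le _)]
      exact phaseField_le (hρB t (Ico_subset_Icc_self ht)) (hσB t (Ico_subset_Icc_self ht)) _
  refine tendsto_iff_dist_tendsto_zero.2 ?_
  refine squeeze_zero (fun _ => dist_nonneg) key ?_
  have hc : Continuous fun κ' : ℝ =>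
      gronwallBound 0 (Real.toNNReal (|κ| * B)) (|κ' - κ| * B) (q - p) :=
    (gronwallBound_continuous_ε _ _ _).comp (by fun_prop)
  simpa [gronwallBound_ε0_δ0] using hc.tendsto κ

/-- The principal Dirichlet eigenpair of the system `f' = ρ w`, `w' = -λ σ f`. -/
theorem exists_dirichlet_eigenpair {p q : ℝ} (hpq : p < q) {ρ σ : ℝ → ℝ} (hρ : Continuous ρ)
    (hσ : Continuous σ) (hρ₀ : ∀ x, 0 < ρ x) (hσ₀ : ∀ x, 0 < σ x) :
    ∃ (lam : ℝ) (f w : ℝ → ℝ), 0 < lam ∧ (∀ x ∈ Icc p q, HasDerivAt f (ρ x * w x) x) ∧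
      (∀ x ∈ Icc p q, HasDerivAt w (-(lam * σ x * f x)) x) ∧ f p = 0 ∧ f q = 0 ∧
      ∀ x ∈ Ioo p q, 0 < f x := by
  choose φ h0 hφ using exists_phase hpq.le hρ hσ hρ₀ hσ₀
  obtain ⟨c₁, hc₁, hm₁⟩ := (isCompact_Icc (a := p) (b := q)).exists_isMinOn
    (nonempty_Icc.2 hpq.le) hρ.continuousOn
  obtain ⟨c₂, hc₂, hm₂⟩ := (isCompact_Icc (a := p) (b := q)).exists_isMinOn
    (nonempty_Icc.2 hpq.le) hσ.continuousOn
  set m := min (ρ c₁) (σ c₂)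
  have hm : 0 < m := lt_min (hρ₀ _) (hσ₀ _)
  have hmG : ∀ t ∈ Icc p q, ∀ y, m ≤ phaseField ρ σ t y := fun t ht y =>
    le_phaseField ((min_le_left _ _).trans (hm₁ ht)) ((min_le_right _ _).trans (hm₂ ht)) y
  have hcφ : ∀ κ, ContinuousOn (φ κ) (Icc p q) := fun κ t ht =>
    (hφ κ t ht).continuousAt.continuousWithinAt
  have hend0 : φ 0 q = 0 := by
    refine Eq.trans ?_ (h0 0)
    refine (constant_of_has_deriv_right_zero (hcφ 0) (fun t ht => ?_)) q ⟨hpq.le, le_rfl⟩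
    simpa using (hφ 0 t (Ico_subset_Icc_self ht)).hasDerivWithinAt
  -- The phase grows at rate at least `κ m`, so this `κ` forces a total increase of at least `π`.
  set κ₁ := Real.pi / (m * (q - p))
  have hqp : 0 < q - p := sub_pos.2 hpq
  have hκ₁ : 0 < κ₁ := div_pos Real.pi_pos (mul_pos hm hqp)
  have hend1 : Real.pi ≤ φ κ₁ q := by
    obtain ⟨c, hc, hceq⟩ := exists_hasDerivAt_eq_slope (φ κ₁) _ hpq (hcφ κ₁)
      (fun t ht => hφ κ₁ t (Ioo_subset_Icc_self ht))
    have h1 := hmG c (Ioo_subset_Icc_self hc) (φ κ₁ c)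
    rw [h0, sub_zero, eq_div_iff hqp.ne'] at hceq
    rw [← hceq]
    calc Real.pi = κ₁ * m * (q - p) := by
          simp only [κ₁]; field_simp
      _ ≤ _ := by gcongr
  -- Shooting: a phase running from `0` to exactly `π` makes `sin φ` vanish at both ends and, by
  -- monotonicity, stay positive between.
  obtain ⟨κ, hκ, hκπ⟩ : ∃ κ ∈ Icc 0 κ₁, φ κ q = Real.pi :=
    intermediate_value_Icc hκ₁.le
      (continuous_phase_end hpq.le hρ hσ hρ₀ hσ₀ h0 hφ).continuousOn
      ⟨by simpa only [hend0] using Real.pi_pos.le, hend1⟩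
  have hκ0 : 0 < κ := hκ.1.lt_of_ne fun h => by
    rw [← h, hend0] at hκπ; exact Real.pi_pos.ne hκπ
  have hmono : StrictMonoOn (φ κ) (Icc p q) := by
    refine strictMonoOn_of_deriv_pos (convex_Icc p q) (hcφ κ) fun t ht => ?_
    rw [interior_Icc] at ht
    rw [(hφ κ t (Ioo_subset_Icc_self ht)).deriv]
    exact mul_pos hκ0 (hm.trans_le (hmG t (Ioo_subset_Icc_self ht) _))
  set ψ : ℝ → ℝ := IccExtend hpq.le ((Icc p q).domRestrict (φ κ))
  have hψ : Continuous ψ := (continuousOn_iff_continuous_domRestrict.1 (hcφ κ)).Icc_extend'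
  have hψφ : ∀ t ∈ Icc p q, ψ t = φ κ t := fun t ht => IccExtend_of_mem hpq.le _ ht
  -- The logarithmic derivative of the Prüfer amplitude. Using the extended phase `ψ` makes it
  -- continuous on the line, so its primitive `R` is differentiable at the endpoints too.
  set g : ℝ → ℝ := fun t => κ * (ρ t - σ t) * (Real.sin (ψ t) * Real.cos (ψ t))
  have hg : Continuous g := by fun_prop
  set R : ℝ → ℝ := fun x => ∫ t in p..x, g t
  have hR : ∀ x, HasDerivAt R (g x) x := fun x =>
    intervalIntegral.integral_hasDerivAt_right (hg.intervalIntegrable _ _)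
      (hg.stronglyMeasurableAtFilter _ _) hg.continuousAt
  -- The phase belongs to the symmetric system `f' = κ ρ v`, `v' = -κ σ f`; putting `w = κ v` gives
  -- eigenvalue `κ²`.
  refine ⟨κ ^ 2, fun x => Real.exp (R x) * Real.sin (φ κ x),
    fun x => κ * (Real.exp (R x) * Real.cos (φ κ x)), by positivity, ?_, ?_, ?_, ?_, ?_⟩
  · intro x hx
    refine ((hR x).exp.mul (hφ κ x hx).sin).congr_deriv ?_
    simp only [g, hψφ x hx, phaseField]
    linear_combination (κ * Real.exp (R x) * Real.cos (φ κ x) * ρ x) *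
      Real.sin_sq_add_cos_sq (φ κ x)
  · intro x hx
    refine (((hR x).exp.mul (hφ κ x hx).cos).const_mul κ).congr_deriv ?_
    simp only [g, hψφ x hx, phaseField]
    linear_combination (-κ * κ * Real.exp (R x) * Real.sin (φ κ x) * σ x) *
      Real.sin_sq_add_cos_sq (φ κ x)
  · simp [h0]
  · simp [hκπ]
  · intro x hx
    have hp : p ∈ Icc p q := left_mem_Icc.2 hpq.le
    have hq : q ∈ Icc p q := right_mem_Icc.2 hpq.le
    have h1 := hmono hp (Ioo_subset_Icc_self hx) hx.1
    have h2 := hmono (Ioo_subset_Icc_self hx) hq hx.2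
    rw [h0] at h1
    rw [hκπ] at h2
    exact mul_pos (Real.exp_pos _) (Real.sin_pos_of_pos_of_lt_pi h1 h2)

end

/-! ### The Poincaré inequality from an eigenpair -/

/-- `(f, w)` solves `f' = ρ w`, `w' = -λ σ f` on `[p, q]`, with `f` positive inside and vanishing
at both ends. -/
structure IsDirichletEigenpair (p q : ℝ) (ρ σ : ℝ → ℝ) (lam : ℝ) (f w : ℝ → ℝ) : Prop where
  lam_pos : 0 < lam
  hasDerivAt_fst : ∀ x ∈ Icc p q, HasDerivAt f (ρ x * w x) x
  hasDerivAt_snd : ∀ x ∈ Icc p q, HasDerivAt w (-(lam * σ x * f x)) x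
  left_eq_zero : f p = 0
  right_eq_zero : f q = 0
  pos : ∀ x ∈ Ioo p q, 0 < f x

theorem lintegral_Ioc_eq_of_hasDerivAt {F h : ℝ → ℝ} {x y : ℝ} (hxy : x ≤ y)
    (hF : ∀ t ∈ Icc x y, HasDerivAt F (h t) t) (hc : ContinuousOn h (Icc x y))
    (h₀ : ∀ t ∈ Ioc x y, 0 ≤ h t) :
    ∫⁻ t in Ioc x y, ENNReal.ofReal (h t) = ENNReal.ofReal (F y - F x) := by
  have hi : IntervalIntegrable h volume x y := by
    apply ContinuousOn.intervalIntegrable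
    rwa [uIcc_of_le hxy]
  rw [← intervalIntegral.integral_eq_sub_of_hasDerivAt (f := F) (f' := h)
    (by rwa [uIcc_of_le hxy]) hi, intervalIntegral.integral_of_le hxy,
    ofReal_integral_eq_lintegral_ofReal hi.1]
  filter_upwards [ae_restrict_mem measurableSet_Ioc] with t ht using h₀ t ht

/-- A weighted Cauchy–Schwarz inequality. -/
theorem sq_lintegral_le_mul {α : Type*} [MeasurableSpace α] {μ : Measure α} {F H : α → ℝ≥0∞}
    (hF : AEMeasurable F μ) (hH : AEMeasurable H μ) (h₀ : ∀ᵐ x ∂μ, H x ≠ 0)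
    (h₁ : ∀ᵐ x ∂μ, H x ≠ ⊤) :
    (∫⁻ x, F x ∂μ) ^ 2 ≤ (∫⁻ x, F x ^ 2 / H x ∂μ) * ∫⁻ x, H x ∂μ := by
  have hCS := ENNReal.lintegral_mul_le_Lp_mul_Lq μ Real.HolderConjugate.two_two
    (hF.div (hH.pow_const (1 / 2 : ℝ))) (hH.pow_const (1 / 2 : ℝ))
  have e1 : ∫⁻ x, ((F / fun x => H x ^ (1 / 2 : ℝ)) * fun x => H x ^ (1 / 2 : ℝ)) x ∂μ =
      ∫⁻ x, F x ∂μ := by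
    refine lintegral_congr_ae ?_
    filter_upwards [h₀, h₁] with x hx0 hx1
    simp only [Pi.mul_apply, Pi.div_apply]
    refine ENNReal.div_mul_cancel ?_ ?_
    · simp [ENNReal.rpow_eq_zero_iff, hx0]
    · simp [ENNReal.rpow_eq_top_iff, hx1]
  have e2 : ∫⁻ x, (F / fun x => H x ^ (1 / 2 : ℝ)) x ^ (2 : ℝ) ∂μ = ∫⁻ x, F x ^ 2 / H x ∂μ := by
    refine lintegral_congr fun x => ?_
    rw [Pi.div_apply, ENNReal.div_rpow_of_nonneg _ _ (by norm_num), ← ENNReal.rpow_mul]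
    norm_num
  have e3 : ∫⁻ x, (H x ^ (1 / 2 : ℝ)) ^ (2 : ℝ) ∂μ = ∫⁻ x, H x ∂μ := by
    refine lintegral_congr fun x => ?_
    rw [← ENNReal.rpow_mul]
    norm_num
  rw [e1, e2, e3] at hCS
  calc (∫⁻ x, F x ∂μ) ^ 2 ≤ _ := pow_le_pow_left' hCS 2
    _ = _ := by
      rw [mul_pow, ← ENNReal.rpow_natCast, ← ENNReal.rpow_natCast, ← ENNReal.rpow_mul,
        ← ENNReal.rpow_mul]
      norm_num

namespace IsDirichletEigenpair

variable {p q : ℝ} {ρ σ : ℝ → ℝ} {lam : ℝ} {f w : ℝ → ℝ}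

theorem continuousOn_fst (h : IsDirichletEigenpair p q ρ σ lam f w) : ContinuousOn f (Icc p q) :=
  fun x hx => (h.hasDerivAt_fst x hx).continuousAt.continuousWithinAt

theorem continuousOn_snd (h : IsDirichletEigenpair p q ρ σ lam f w) : ContinuousOn w (Icc p q) :=
  fun x hx => (h.hasDerivAt_snd x hx).continuousAt.continuousWithinAt

theorem strictAntiOn_snd (h : IsDirichletEigenpair p q ρ σ lam f w) (hσ₀ : ∀ x, 0 < σ x) :
    StrictAntiOn w (Icc p q) := by
  refine strictAntiOn_of_deriv_neg (convex_Icc p q) h.continuousOn_snd fun t ht => ?_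
  rw [interior_Icc] at ht
  rw [(h.hasDerivAt_snd t (Ioo_subset_Icc_self ht)).deriv]
  exact neg_neg_of_pos (mul_pos (mul_pos h.lam_pos (hσ₀ t)) (h.pos t ht))

/-- Rolle's theorem for `f`, as `f' = ρ w`. Since `w` is strictly decreasing, this zero is its only
sign change. -/
theorem exists_snd_eq_zero (h : IsDirichletEigenpair p q ρ σ lam f w) (hpq : p < q)
    (hρ₀ : ∀ x, 0 < ρ x) : ∃ x ∈ Ioo p q, w x = 0 := by
  obtain ⟨c, hc, hc0⟩ := exists_hasDerivAt_eq_zero hpq h.continuousOn_fst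
    (h.left_eq_zero.trans h.right_eq_zero.symm)
    (fun x hx => h.hasDerivAt_fst x (Ioo_subset_Icc_self hx))
  exact ⟨c, hc, (mul_eq_zero.1 hc0).resolve_left (hρ₀ c).ne'⟩

theorem smul (h : IsDirichletEigenpair p q ρ σ lam f w) {c : ℝ} (hc : 0 < c) :
    IsDirichletEigenpair p q ρ σ lam (fun x => c * f x) fun x => c * w x where
  lam_pos := h.lam_pos
  hasDerivAt_fst x hx := ((h.hasDerivAt_fst x hx).const_mul c).congr_deriv (by ring)
  hasDerivAt_snd x hx := ((h.hasDerivAt_snd x hx).const_mul c).congr_deriv (by ring)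
  left_eq_zero := by simp [h.left_eq_zero]
  right_eq_zero := by simp [h.right_eq_zero]
  pos x hx := mul_pos hc (h.pos x hx)

/-- The pointwise bound behind the Poincaré inequality. -/
theorem enorm_sub_sq_le (h : IsDirichletEigenpair p q ρ σ lam f w) (hσ : Continuous σ)
    (hσ₀ : ∀ x, 0 < σ x) {g : ℝ → ℝ}
    (hg : ∀ x y, p < x → x ≤ y → y < q → AbsolutelyContinuousOnInterval g x y)
    {x₀ x : ℝ} (hx₀ : x₀ ∈ Ioo p q) (hw : w x₀ = 0) (hx : x ∈ Ioo p q) :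
    ‖g x - g x₀‖ₑ ^ 2 ≤
      (∫⁻ u in uIoc x₀ x, ‖deriv g u‖ₑ ^ 2 / ENNReal.ofReal (lam * σ u * f u)) *
        ENNReal.ofReal |w x| := by
  have hsub : uIcc x₀ x ⊆ Ioo p q := ordConnected_Ioo.uIcc_subset hx₀ hx
  have hAC : AbsolutelyContinuousOnInterval g x₀ x := by
    rcases le_total x₀ x with hle | hle
    · exact hg _ _ hx₀.1 hle hx.2
    · exact (hg _ _ hx.1 hle hx₀.2).symm
  have hcont : ContinuousOn (fun u => lam * σ u * f u) (uIcc x₀ x) :=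
    (continuousOn_const.mul hσ.continuousOn).mul
      (h.continuousOn_fst.mono (hsub.trans Ioo_subset_Icc_self))
  have hpos : ∀ u ∈ Ioo p q, 0 < lam * σ u * f u := fun u hu =>
    mul_pos (mul_pos h.lam_pos (hσ₀ u)) (h.pos u hu)
  -- The weight is `-w'`, and `w x₀ = 0`, so its mass between `x₀` and `x` is `|w x|`.
  have hH : ∫⁻ u in uIoc x₀ x, ENNReal.ofReal (lam * σ u * f u) = ENNReal.ofReal |w x| := by
    have hd : ∀ t ∈ Ioo p q, HasDerivAt (fun x => -w x) (lam * σ t * f t) t := fun t ht =>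
      (h.hasDerivAt_snd t (Ioo_subset_Icc_self ht)).neg.congr_deriv (neg_neg _)
    have hanti := h.strictAntiOn_snd hσ₀
    rcases le_total x₀ x with hle | hle
    · rw [uIcc_of_le hle] at hsub hcont
      have hwx := hanti.antitoneOn (Ioo_subset_Icc_self hx₀) (Ioo_subset_Icc_self hx) hle
      rw [uIoc_of_le hle, lintegral_Ioc_eq_of_hasDerivAt hle (fun t ht => hd t (hsub ht)) hcont
        (fun t ht => (hpos t (hsub (Ioc_subset_Icc_self ht))).le), hw,
        abs_of_nonpos (hw ▸ hwx)]
      simp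
    · rw [uIcc_of_ge hle] at hsub hcont
      have hwx := hanti.antitoneOn (Ioo_subset_Icc_self hx) (Ioo_subset_Icc_self hx₀) hle
      rw [uIoc_of_ge hle, lintegral_Ioc_eq_of_hasDerivAt hle (fun t ht => hd t (hsub ht)) hcont
        (fun t ht => (hpos t (hsub (Ioc_subset_Icc_self ht))).le), hw,
        abs_of_nonneg (hw ▸ hwx)]
      simp
  have hmem : ∀ᵐ u ∂(volume.restrict (uIoc x₀ x)), u ∈ Ioo p q := by
    filter_upwards [ae_restrict_mem measurableSet_uIoc] with u hu
    exact hsub (uIoc_subset_uIcc hu)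
  rw [← hH]
  refine le_trans (pow_le_pow_left' ?_ 2) (sq_lintegral_le_mul
    ((measurable_deriv g).enorm.aemeasurable) ?_ ?_ ?_)
  · rw [← hAC.integral_deriv_eq_sub, ← ofReal_norm,
      intervalIntegral.norm_intervalIntegral_eq, ofReal_norm]
    exact enorm_integral_le_lintegral_enorm _
  · exact ((hcont.mono uIoc_subset_uIcc).aemeasurable measurableSet_uIoc).ennreal_ofReal
  · filter_upwards [hmem] with u hu
    simpa using hpos u hu
  · exact Filter.Eventually.of_forall fun u => ENNReal.ofReal_ne_top

open scoped Classical in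
/-- The mass of `ρ |w|` on the points separated from the zero `x₀` of `w` by `u`. -/
theorem lintegral_indicator_le (h : IsDirichletEigenpair p q ρ σ lam f w) (hρ : Continuous ρ)
    (hρ₀ : ∀ x, 0 < ρ x) (hσ₀ : ∀ x, 0 < σ x) {x₀ u : ℝ} (hx₀ : x₀ ∈ Ioo p q) (hw : w x₀ = 0)
    (hu : u ∈ Ioo p q) :
    ∫⁻ x in Ioo p q, (if u ∈ uIoc x₀ x then ENNReal.ofReal (ρ x * |w x|) else 0) ≤
      ENNReal.ofReal (f u) := by
  have hanti := (h.strictAntiOn_snd hσ₀).antitoneOn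
  have hc : ContinuousOn (fun x => ρ x * w x) (Icc p q) := hρ.continuousOn.mul h.continuousOn_snd
  rcases lt_or_ge x₀ u with hlt | hge
  -- To the right of `x₀` only `x ≥ u` contribute; there `ρ |w| = -f'`, which integrates to `f u - f
  -- q = f u`.
  · have hwn : ∀ x ∈ Icc u q, w x ≤ 0 := fun x hx => by
      have := hanti (Ioo_subset_Icc_self hx₀) ⟨hu.1.le.trans hx.1, hx.2⟩ (hlt.le.trans hx.1)
      rwa [hw] at this
    have hsub : Icc u q ⊆ Icc p q := Icc_subset_Icc_left hu.1.le
    have hint := lintegral_Ioc_eq_of_hasDerivAt (F := fun x => -f x) (h := fun x => -(ρ x * w x))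
      hu.2.le (fun t ht => (h.hasDerivAt_fst t (hsub ht)).neg) (hc.neg.mono hsub)
      (fun t ht => neg_nonneg.2 (mul_nonpos_of_nonneg_of_nonpos (hρ₀ t).le
        (hwn t (Ioc_subset_Icc_self ht))))
    rw [h.right_eq_zero, neg_zero, zero_sub, neg_neg] at hint
    rw [← hint, ← lintegral_indicator measurableSet_Ioo, Measure.restrict_congr_set Ioc_ae_eq_Icc,
      ← lintegral_indicator measurableSet_Icc]
    refine lintegral_mono fun x => ?_
    by_cases hx : x ∈ Ioo p q
    · rw [indicator_of_mem hx]
      split_ifs with hux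
      · have hux' : u ≤ x := by
          rcases mem_uIoc.1 hux with h' | h'
          · exact h'.2
          · exact absurd h'.2 hlt.not_ge
        have hxm : x ∈ Icc u q := ⟨hux', hx.2.le⟩
        rw [indicator_of_mem hxm, abs_of_nonpos (hwn x hxm), mul_neg]
      · exact zero_le
    · rw [indicator_of_notMem hx]
      exact zero_le
  -- To the left of `x₀`, or at `x₀`, only `x < u` contribute; there `ρ |w| = f'`, which integrates
  -- to `f u - f p = f u`.
  · have hwn : ∀ x ∈ Icc p u, 0 ≤ w x := fun x hx => by
      have := hanti ⟨hx.1, hx.2.trans hu.2.le⟩ (Ioo_subset_Icc_self hx₀) (hx.2.trans hge)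
      rwa [hw] at this
    have hsub : Icc p u ⊆ Icc p q := Icc_subset_Icc_right hu.2.le
    have hint := lintegral_Ioc_eq_of_hasDerivAt (F := f) (h := fun x => ρ x * w x)
      hu.1.le (fun t ht => h.hasDerivAt_fst t (hsub ht)) (hc.mono hsub)
      (fun t ht => mul_nonneg (hρ₀ t).le (hwn t (Ioc_subset_Icc_self ht)))
    rw [h.left_eq_zero, sub_zero] at hint
    rw [← hint, ← lintegral_indicator measurableSet_Ioo,
      ← lintegral_indicator measurableSet_Ioc]
    refine lintegral_mono fun x => ?_
    by_cases hx : x ∈ Ioo p q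
    · rw [indicator_of_mem hx]
      split_ifs with hux
      · have hux' : x < u := by
          rcases mem_uIoc.1 hux with h' | h'
          · exact absurd h'.1 hge.not_gt
          · exact h'.1
        rw [indicator_of_mem (show x ∈ Ioc p u from ⟨hx.1, hux'.le⟩),
          abs_of_nonneg (hwn x ⟨hx.1.le, hux'.le⟩)]
      · exact zero_le
    · rw [indicator_of_notMem hx]
      exact zero_le

open scoped Classical in
/-- The Poincaré inequality, centred at the zero `x₀` of `w`. -/
theorem lintegral_sub_sq_le (h : IsDirichletEigenpair p q ρ σ lam f w) (hρ : Continuous ρ)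
    (hσ : Continuous σ) (hρ₀ : ∀ x, 0 < ρ x) (hσ₀ : ∀ x, 0 < σ x) {g : ℝ → ℝ}
    (hg : ∀ x y, p < x → x ≤ y → y < q → AbsolutelyContinuousOnInterval g x y)
    {x₀ : ℝ} (hx₀ : x₀ ∈ Ioo p q) (hw : w x₀ = 0) :
    ∫⁻ x in Ioo p q, ENNReal.ofReal (ρ x) * ‖g x - g x₀‖ₑ ^ 2 ≤
      ENNReal.ofReal lam⁻¹ *
        ∫⁻ u in Ioo p q, ENNReal.ofReal (σ u)⁻¹ * ‖deriv g u‖ₑ ^ 2 := by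
  set K : ℝ → ℝ≥0∞ := fun u => ‖deriv g u‖ₑ ^ 2 / ENNReal.ofReal (lam * σ u * f u)
  have hcont : ContinuousOn (fun u => lam * σ u * f u) (Ioo p q) :=
    (continuousOn_const.mul hσ.continuousOn).mul (h.continuousOn_fst.mono Ioo_subset_Icc_self)
  have hK : AEMeasurable K (volume.restrict (Ioo p q)) :=
    ((measurable_deriv g).enorm.pow_const 2).aemeasurable.div
      (hcont.aemeasurable measurableSet_Ioo).ennreal_ofReal
  have hW : AEMeasurable (fun x => ENNReal.ofReal (ρ x * |w x|)) (volume.restrict (Ioo p q)) :=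
    ((hρ.continuousOn.mul (h.continuousOn_snd.mono Ioo_subset_Icc_self).abs).aemeasurable
      measurableSet_Ioo).ennreal_ofReal
  have hS : MeasurableSet {z : ℝ × ℝ | z.2 ∈ uIoc x₀ z.1} := by
    simp only [uIoc, mem_Ioc, ofPred_and]
    exact (measurableSet_lt (by fun_prop) (by fun_prop)).inter
      (measurableSet_le (by fun_prop) (by fun_prop))
  calc ∫⁻ x in Ioo p q, ENNReal.ofReal (ρ x) * ‖g x - g x₀‖ₑ ^ 2
      ≤ ∫⁻ x in Ioo p q, ∫⁻ u in Ioo p q,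
          K u * (if u ∈ uIoc x₀ x then ENNReal.ofReal (ρ x * |w x|) else 0) := by
        refine setLIntegral_mono' measurableSet_Ioo fun x hx => ?_
        have hsub : uIoc x₀ x ⊆ Ioo p q :=
          uIoc_subset_uIcc.trans (ordConnected_Ioo.uIcc_subset hx₀ hx)
        calc ENNReal.ofReal (ρ x) * ‖g x - g x₀‖ₑ ^ 2
            ≤ ENNReal.ofReal (ρ x) * ((∫⁻ u in uIoc x₀ x, K u) * ENNReal.ofReal |w x|) :=
              mul_le_mul_right (h.enorm_sub_sq_le hσ hσ₀ hg hx₀ hw hx) _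
          _ = (∫⁻ u in uIoc x₀ x, K u) * ENNReal.ofReal (ρ x * |w x|) := by
              rw [ENNReal.ofReal_mul (hρ₀ x).le]; ring
          _ = ∫⁻ u in uIoc x₀ x, K u * ENNReal.ofReal (ρ x * |w x|) :=
              (lintegral_mul_const' _ _ ENNReal.ofReal_ne_top).symm
          _ = ∫⁻ u in Ioo p q, (uIoc x₀ x).indicator
                (fun u => K u * ENNReal.ofReal (ρ x * |w x|)) u := by
              rw [lintegral_indicator measurableSet_uIoc,
                Measure.restrict_restrict measurableSet_uIoc, inter_eq_left.2 hsub]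
          _ ≤ _ := by
              refine lintegral_mono fun u => ?_
              by_cases hu : u ∈ uIoc x₀ x <;> simp [hu]
    _ = ∫⁻ u in Ioo p q, ∫⁻ x in Ioo p q,
          K u * (if u ∈ uIoc x₀ x then ENNReal.ofReal (ρ x * |w x|) else 0) := by
        refine lintegral_lintegral_swap ?_
        refine (hK.comp_snd).mul ?_
        exact (hW.comp_fst.indicator hS).congr (Filter.Eventually.of_forall fun z => by
          simp [indicator_apply])
    _ ≤ ∫⁻ u in Ioo p q, K u * ENNReal.ofReal (f u) := by
        refine setLIntegral_mono' measurableSet_Ioo fun u hu => ?_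
        have hK' : K u ≠ ⊤ := ENNReal.div_ne_top (by simp) (by
          simpa using mul_pos (mul_pos h.lam_pos (hσ₀ u)) (h.pos u hu))
        rw [lintegral_const_mul' _ _ hK']
        exact mul_le_mul_right (h.lintegral_indicator_le hρ hρ₀ hσ₀ hx₀ hw hu) _
    -- The factor `f u` cancels against the weight `λ σ f` in the denominator of `K`.
    _ = ∫⁻ u in Ioo p q, ENNReal.ofReal lam⁻¹ *
          (ENNReal.ofReal (σ u)⁻¹ * ‖deriv g u‖ₑ ^ 2) := by
        refine setLIntegral_congr_fun measurableSet_Ioo fun u hu => ?_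
        have hf := h.pos u hu
        have hl := h.lam_pos
        have hs := hσ₀ u
        simp only [K]
        rw [div_eq_mul_inv, ← ENNReal.ofReal_inv_of_pos (by positivity), mul_assoc,
          ← ENNReal.ofReal_mul (by positivity), ← mul_assoc,
          ← ENNReal.ofReal_mul (by positivity), mul_comm]
        congr 2
        field_simp
    _ = _ := lintegral_const_mul' _ _ ENNReal.ofReal_ne_top

end IsDirichletEigenpair

/-! ### Continuous extension of the coefficients, and measure-theoretic tools -/

/-- The potential agrees on the closed interval with a `C¹` function on the line. -/
theorem exists_contDiff_eqOn_potential {p q θ : ℝ} (hpq : p < q) (hθ : θ ∈ Ioo p q) {a b : ℝ → ℝ}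
    (ha : ContinuousOn a (Icc p q)) (hb : ContinuousOn b (Icc p q))
    (hpos : ∀ x ∈ Icc p q, 0 < a x) :
    ∃ C : ℝ → ℝ, ContDiff ℝ 1 C ∧ EqOn (potential a b θ) C (Icc p q) ∧
      ∀ x ∈ Icc p q, HasDerivAt C (b x / a x) x := by
  have hba : ContinuousOn (fun x => b x / a x) (Icc p q) :=
    hb.div ha fun x hx => (hpos x hx).ne'
  -- Extending by the endpoint values gives a primitive with two-sided derivatives at the endpoints
  -- as well.
  set g : ℝ → ℝ := IccExtend hpq.le ((Icc p q).domRestrict fun x => b x / a x)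
  have hg : Continuous g := (continuousOn_iff_continuous_domRestrict.1 hba).Icc_extend'
  have hgeq : ∀ x ∈ Icc p q, g x = b x / a x := fun x hx => IccExtend_of_mem hpq.le _ hx
  have hC : ∀ x, HasDerivAt (fun x => ∫ t in θ..x, g t) (g x) x := fun x =>
    intervalIntegral.integral_hasDerivAt_right (hg.intervalIntegrable _ _)
      (hg.stronglyMeasurableAtFilter _ _) hg.continuousAt
  refine ⟨fun x => ∫ t in θ..x, g t, ?_, fun x hx => ?_, fun x hx => hgeq x hx ▸ hC x⟩
  · refine contDiff_one_iff_deriv.2 ⟨fun x => (hC x).differentiableAt, ?_⟩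
    rwa [show deriv (fun x => ∫ t in θ..x, g t) = g from funext fun x => (hC x).deriv]
  · refine intervalIntegral.integral_congr fun t ht => ?_
    exact (hgeq t (ordConnected_Icc.uIcc_subset (Ioo_subset_Icc_self hθ) hx ht)).symm

/-- Continuous positive functions on the line extending the densities of `μ` and `ν̂`. -/
theorem exists_density_extension {p q θ : ℝ} (hpq : p < q) (hθ : θ ∈ Ioo p q) {a b : ℝ → ℝ}
    (ha : ContinuousOn a (Icc p q)) (hb : ContinuousOn b (Icc p q))
    (hpos : ∀ x ∈ Icc p q, 0 < a x) :
    ∃ ρ σ : ℝ → ℝ, Continuous ρ ∧ Continuous σ ∧ (∀ x, 0 < ρ x) ∧ (∀ x, 0 < σ x) ∧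
      EqOn (muDensity a b θ) ρ (Icc p q) ∧ EqOn (nuHatDensity a b θ) σ (Icc p q) ∧
      EqOn (nuDensity a b θ) (fun x => (σ x)⁻¹) (Icc p q) := by
  obtain ⟨C, hC, hCeq, -⟩ := exists_contDiff_eqOn_potential hpq hθ ha hb hpos
  set a' : ℝ → ℝ := IccExtend hpq.le ((Icc p q).domRestrict a)
  have ha' : Continuous a' := (continuousOn_iff_continuous_domRestrict.1 ha).Icc_extend'
  have haeq : ∀ x ∈ Icc p q, a' x = a x := fun x hx => IccExtend_of_mem hpq.le _ hx
  have hapos : ∀ x, 0 < a' x := fun x => hpos _ (projIcc p q hpq.le x).2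
  refine ⟨fun x => Real.exp (C x) / a' x, fun x => Real.exp (-C x),
    (Real.continuous_exp.comp hC.continuous).div ha' fun x => (hapos x).ne',
    Real.continuous_exp.comp hC.continuous.neg, fun x => div_pos (Real.exp_pos _) (hapos x),
    fun x => Real.exp_pos _, fun x hx => ?_, fun x hx => ?_, fun x hx => ?_⟩
  · simp only [muDensity, hCeq hx, haeq x hx]
  · simp only [nuHatDensity, hCeq hx]
  · simp only [nuDensity, hCeq hx, Real.exp_neg, inv_inv]

theorem withDensity_restrict_congr {s : Set ℝ} (hs : MeasurableSet s) {r r' : ℝ → ℝ}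
    (h : EqOn r r' s) :
    (volume.restrict s).withDensity (fun x => ENNReal.ofReal (r x)) =
      (volume.restrict s).withDensity (fun x => ENNReal.ofReal (r' x)) := by
  refine withDensity_congr_ae ?_
  filter_upwards [ae_restrict_mem hs] with x hx
  rw [h hx]

theorem eLpNorm_two_sq {α : Type*} [MeasurableSpace α] (μ : Measure α) (g : α → ℝ) :
    eLpNorm g 2 μ ^ 2 = ∫⁻ x, ‖g x‖ₑ ^ 2 ∂μ := by
  have := eLpNorm_nnreal_pow_eq_lintegral (μ := μ) (f := g) (p := 2) (by norm_num)
  simpa using this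

theorem lintegral_withDensity_ofReal {ρ : ℝ → ℝ} (hρ : Continuous ρ) (s : Set ℝ) (F : ℝ → ℝ≥0∞) :
    ∫⁻ x, F x ∂((volume.restrict s).withDensity fun x => ENNReal.ofReal (ρ x)) =
      ∫⁻ x in s, ENNReal.ofReal (ρ x) * F x :=
  lintegral_withDensity_eq_lintegral_mul_non_measurable _ hρ.measurable.ennreal_ofReal
    (Filter.Eventually.of_forall fun _ => ENNReal.ofReal_lt_top) F

theorem isFiniteMeasure_withDensity_Ioo {ρ : ℝ → ℝ} (hρ : Continuous ρ) (p q : ℝ) :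
    IsFiniteMeasure ((volume.restrict (Ioo p q)).withDensity fun x => ENNReal.ofReal (ρ x)) :=
  isFiniteMeasure_withDensity_ofReal
    ((hρ.integrableOn_Icc (a := p) (b := q)).mono_set Ioo_subset_Icc_self).hasFiniteIntegral

theorem withDensity_Ioo_ne_zero {p q : ℝ} (hpq : p < q) {ρ : ℝ → ℝ} (hρ : Continuous ρ)
    (hρ₀ : ∀ x, 0 < ρ x) :
    (volume.restrict (Ioo p q)).withDensity (fun x => ENNReal.ofReal (ρ x)) ≠ 0 := by
  rw [Ne, withDensity_eq_zero_iff hρ.measurable.ennreal_ofReal.aemeasurable]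
  intro h
  have hfalse : ∀ᵐ _x ∂(volume.restrict (Ioo p q)), False := by
    filter_upwards [h] with x hx
    simp [(hρ₀ x).not_ge] at hx
  rw [Filter.eventually_false_iff_eq_bot, ae_eq_bot, Measure.restrict_eq_zero, Real.volume_Ioo] at hfalse
  exact (ENNReal.ofReal_pos.2 (sub_pos.2 hpq)).ne' hfalse

/-- The mean minimizes the quadratic deviation. -/
theorem lintegral_sub_mean_sq_le {α : Type*} [MeasurableSpace α] {μ : Measure α}
    [IsFiniteMeasure μ] (hμ : μ ≠ 0) {g : α → ℝ} (hg : MemLp g 2 μ) (d : ℝ) :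
    ∫⁻ x, ‖g x - ∫ y, g y ∂((μ univ)⁻¹ • μ)‖ₑ ^ 2 ∂μ ≤ ∫⁻ x, ‖g x - d‖ₑ ^ 2 ∂μ := by
  have hZ : μ univ ≠ 0 := Measure.measure_univ_ne_zero.2 hμ
  have hZ' : μ univ ≠ ⊤ := measure_ne_top μ univ
  have : NeZero μ := ⟨hμ⟩
  have : IsProbabilityMeasure ((μ univ)⁻¹ • μ) := inferInstance
  have hgπ : MemLp g 2 ((μ univ)⁻¹ • μ) := hg.smul_measure (ENNReal.inv_ne_top.2 hZ)
  have hgi : Integrable g ((μ univ)⁻¹ • μ) := hgπ.integrable (by norm_num)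
  have hsm : AEStronglyMeasurable (fun x => g x - d) ((μ univ)⁻¹ • μ) :=
    hgπ.1.sub aestronglyMeasurable_const
  -- The variance of `g - d` does not depend on `d` and is at most its second moment.
  have key : ProbabilityTheory.evariance (fun x => g x - d) ((μ univ)⁻¹ • μ) ≤
      ∫⁻ x, ‖g x - d‖ₑ ^ 2 ∂((μ univ)⁻¹ • μ) := by
    rw [ProbabilityTheory.evariance_def' hsm]
    exact tsub_le_self
  have hmean : ∫ y, (g y - d) ∂((μ univ)⁻¹ • μ) = (∫ y, g y ∂((μ univ)⁻¹ • μ)) - d := by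
    rw [integral_sub hgi (integrable_const d)]
    simp
  rw [ProbabilityTheory.evariance, hmean] at key
  simp only [sub_sub_sub_cancel_right] at key
  rw [lintegral_smul_measure, lintegral_smul_measure] at key
  exact (ENNReal.mul_le_mul_iff_right (ENNReal.inv_ne_zero.2 hZ')
    (ENNReal.inv_ne_top.2 hZ)).1 key

/-! ### Mean, norm and energy of the Neumann eigenfunction `w` -/

namespace IsDirichletEigenpair

variable {p q : ℝ} {ρ σ : ℝ → ℝ} {lam : ℝ} {f w : ℝ → ℝ}

/-- The integrand is `f'` and `f` vanishes at both ends; this makes `w` a centred competitor for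
`λ₁`. -/
theorem integral_mul_snd_eq_zero (h : IsDirichletEigenpair p q ρ σ lam f w) (hpq : p < q)
    (hρ : Continuous ρ) : ∫ x in p..q, ρ x * w x = 0 := by
  rw [intervalIntegral.integral_eq_sub_of_hasDerivAt (f := f)
    (by rw [uIcc_of_le hpq.le]; exact h.hasDerivAt_fst), h.left_eq_zero, h.right_eq_zero, sub_zero]
  apply ContinuousOn.intervalIntegrable
  rw [uIcc_of_le hpq.le]
  exact hρ.continuousOn.mul h.continuousOn_snd

/-- Integration by parts: the difference of the two integrands is `(f w)'`. -/
theorem integral_sq_eq (h : IsDirichletEigenpair p q ρ σ lam f w) (hpq : p < q)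
    (hρ : Continuous ρ) (hσ : Continuous σ) :
    ∫ x in p..q, ρ x * w x ^ 2 = lam * ∫ x in p..q, σ x * f x ^ 2 := by
  have h1 : IntervalIntegrable (fun x => ρ x * w x ^ 2) volume p q := by
    apply ContinuousOn.intervalIntegrable
    rw [uIcc_of_le hpq.le]
    exact hρ.continuousOn.mul (h.continuousOn_snd.pow 2)
  have h2 : IntervalIntegrable (fun x => lam * (σ x * f x ^ 2)) volume p q := by
    apply ContinuousOn.intervalIntegrable
    rw [uIcc_of_le hpq.le]
    exact continuousOn_const.mul (hσ.continuousOn.mul (h.continuousOn_fst.pow 2))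
  rw [← intervalIntegral.integral_const_mul, ← sub_eq_zero, ← intervalIntegral.integral_sub h1 h2,
    intervalIntegral.integral_eq_sub_of_hasDerivAt (f := fun x => f x * w x) _ (h1.sub h2),
    h.left_eq_zero, h.right_eq_zero]
  · ring
  · rw [uIcc_of_le hpq.le]
    intro x hx
    exact ((h.hasDerivAt_fst x hx).mul (h.hasDerivAt_snd x hx)).congr_deriv (by ring)

theorem integral_sq_pos (h : IsDirichletEigenpair p q ρ σ lam f w) (hpq : p < q)
    (hρ : Continuous ρ) (hσ : Continuous σ) (hσ₀ : ∀ x, 0 < σ x) :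
    0 < ∫ x in p..q, ρ x * w x ^ 2 := by
  rw [h.integral_sq_eq hpq hρ hσ]
  refine mul_pos h.lam_pos (intervalIntegral.intervalIntegral_pos_of_pos_on ?_ (fun x hx => ?_) hpq)
  · apply ContinuousOn.intervalIntegrable
    rw [uIcc_of_le hpq.le]
    exact hσ.continuousOn.mul (h.continuousOn_fst.pow 2)
  · exact mul_pos (hσ₀ x) (pow_pos (h.pos x hx) 2)

theorem exists_normalized (h : IsDirichletEigenpair p q ρ σ lam f w) (hpq : p < q)
    (hρ : Continuous ρ) (hσ : Continuous σ) (hσ₀ : ∀ x, 0 < σ x) :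
    ∃ f₁ w₁, IsDirichletEigenpair p q ρ σ lam f₁ w₁ ∧ ∫ x in p..q, ρ x * w₁ x ^ 2 = 1 := by
  have hI := h.integral_sq_pos hpq hρ hσ hσ₀
  set I := ∫ x in p..q, ρ x * w x ^ 2
  refine ⟨_, _, h.smul (inv_pos.2 (Real.sqrt_pos.2 hI)), ?_⟩
  have he : ∀ x, ρ x * ((√I)⁻¹ * w x) ^ 2 = I⁻¹ * (ρ x * w x ^ 2) := fun x => by
    rw [mul_pow, inv_pow, Real.sq_sqrt hI.le]; ring
  simp only [he]
  rw [intervalIntegral.integral_const_mul]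
  exact inv_mul_cancel₀ hI.ne'

theorem absolutelyContinuousOnInterval_snd (h : IsDirichletEigenpair p q ρ σ lam f w)
    (hσ : Continuous σ) {x y : ℝ} (hx : p < x) (hxy : x ≤ y) (hy : y < q) :
    AbsolutelyContinuousOnInterval w x y := by
  have hsub : Icc x y ⊆ Icc p q := Icc_subset_Icc hx.le hy.le
  have hc : ContinuousOn (fun x => -(lam * σ x * f x)) (Icc p q) :=
    ((continuousOn_const.mul hσ.continuousOn).mul h.continuousOn_fst).neg
  obtain ⟨B, hB⟩ := (isCompact_Icc (a := x) (b := y)).exists_bound_of_continuousOn (hc.mono hsub)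
  have hL : LipschitzOnWith (Real.toNNReal B) w (uIcc x y) := by
    rw [uIcc_of_le hxy]
    refine (convex_Icc x y).lipschitzOnWith_of_nnnorm_hasDerivWithin_le
      (fun t ht => (h.hasDerivAt_snd t (hsub ht)).hasDerivWithinAt) fun t ht => ?_
    rw [← NNReal.coe_le_coe, coe_nnnorm]
    exact (hB t ht).trans (Real.le_coe_toNNReal _)
  exact hL.absolutelyContinuousOnInterval

theorem lintegral_snd_sq (h : IsDirichletEigenpair p q ρ σ lam f w) (hpq : p < q)
    (hρ : Continuous ρ) (hρ₀ : ∀ x, 0 < ρ x) :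
    ∫⁻ x in Ioo p q, ENNReal.ofReal (ρ x) * ‖w x‖ₑ ^ 2 =
      ENNReal.ofReal (∫ x in p..q, ρ x * w x ^ 2) := by
  have h1 : IntervalIntegrable (fun x => ρ x * w x ^ 2) volume p q := by
    apply ContinuousOn.intervalIntegrable
    rw [uIcc_of_le hpq.le]
    exact hρ.continuousOn.mul (h.continuousOn_snd.pow 2)
  rw [intervalIntegral.integral_of_le hpq.le, ofReal_integral_eq_lintegral_ofReal h1.1
    (Filter.Eventually.of_forall fun x => mul_nonneg (hρ₀ x).le (sq_nonneg _)),
    Measure.restrict_congr_set Ioo_ae_eq_Ioc]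
  refine lintegral_congr fun x => ?_
  rw [ENNReal.ofReal_mul (hρ₀ x).le, ← enorm_pow, Real.enorm_of_nonneg (sq_nonneg _)]

/-- With `w' = -λ σ f` the energy is `λ² ∫ σ f²`, and `integral_sq_eq` trades one factor `λ` for the
norm of `w`. Thus `w` is extremal in the Poincaré inequality. -/
theorem lintegral_deriv_snd_sq (h : IsDirichletEigenpair p q ρ σ lam f w) (hpq : p < q)
    (hρ : Continuous ρ) (hσ : Continuous σ) (hσ₀ : ∀ x, 0 < σ x) :
    ∫⁻ x in Ioo p q, ENNReal.ofReal (σ x)⁻¹ * ‖deriv w x‖ₑ ^ 2 =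
      ENNReal.ofReal (lam * ∫ x in p..q, ρ x * w x ^ 2) := by
  have h1 : IntervalIntegrable (fun x => lam ^ 2 * (σ x * f x ^ 2)) volume p q := by
    apply ContinuousOn.intervalIntegrable
    rw [uIcc_of_le hpq.le]
    exact continuousOn_const.mul (hσ.continuousOn.mul (h.continuousOn_fst.pow 2))
  rw [h.integral_sq_eq hpq hρ hσ, ← mul_assoc, ← pow_two, ← intervalIntegral.integral_const_mul,
    intervalIntegral.integral_of_le hpq.le, ofReal_integral_eq_lintegral_ofReal h1.1
    (Filter.Eventually.of_forall fun x =>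
      mul_nonneg (sq_nonneg _) (mul_nonneg (hσ₀ x).le (sq_nonneg _))),
    ← Measure.restrict_congr_set Ioo_ae_eq_Ioc]
  refine setLIntegral_congr_fun measurableSet_Ioo fun x hx => ?_
  rw [(h.hasDerivAt_snd x (Ioo_subset_Icc_self hx)).deriv, ← enorm_pow,
    Real.enorm_of_nonneg (sq_nonneg _), ← ENNReal.ofReal_mul (inv_nonneg.2 (hσ₀ x).le)]
  congr 1
  have := (hσ₀ x).ne'
  field_simp

end IsDirichletEigenpair

/-! ### The optimal constant and the variational eigenvalue -/

/-- The spectral data of the problem: the Dirichlet eigenpair of the dual operator determines the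
optimal constant and the variational eigenvalue. -/
theorem optimalConst_eq_and_lambdaOne_eq {M N θ : ℝ} (hMN : -M < N) {a b ρ σ : ℝ → ℝ}
    (hρ : Continuous ρ) (hσ : Continuous σ) (hρ₀ : ∀ x, 0 < ρ x) (hσ₀ : ∀ x, 0 < σ x)
    (hμeq : EqOn (muDensity a b θ) ρ (Icc (-M) N))
    (hνeq : EqOn (nuDensity a b θ) (fun x => (σ x)⁻¹) (Icc (-M) N))
    {lam : ℝ} {f w : ℝ → ℝ} (h : IsDirichletEigenpair (-M) N ρ σ lam f w) :
    optimalConst M N a b θ = ENNReal.ofReal (√lam)⁻¹ ∧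
      lambdaOne M N a b θ = ENNReal.ofReal lam := by
  have hσi : Continuous fun x => (σ x)⁻¹ := hσ.inv₀ fun x => (hσ₀ x).ne'
  have hμ : mu M N a b θ =
      (volume.restrict (Ioo (-M) N)).withDensity fun x => ENNReal.ofReal (ρ x) :=
    withDensity_restrict_congr measurableSet_Ioo (hμeq.mono Ioo_subset_Icc_self)
  have hν : nu M N a b θ =
      (volume.restrict (Ioo (-M) N)).withDensity fun x => ENNReal.ofReal (σ x)⁻¹ :=
    withDensity_restrict_congr measurableSet_Ioo (hνeq.mono Ioo_subset_Icc_self)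
  have : IsFiniteMeasure (mu M N a b θ) := hμ ▸ isFiniteMeasure_withDensity_Ioo hρ _ _
  have hμ0 : mu M N a b θ ≠ 0 := hμ ▸ withDensity_Ioo_ne_zero hMN hρ hρ₀
  have hl := h.lam_pos
  have hs : 0 < √lam := Real.sqrt_pos.2 hl
  have poincare : ∀ g, Admissible M N a b θ g →
      eLpNorm (fun x => g x - ∫ y, g y ∂(piMeasure M N a b θ)) 2 (mu M N a b θ) ≤
        ENNReal.ofReal (√lam)⁻¹ * eLpNorm (deriv g) 2 (nu M N a b θ) := by
    intro g hg
    obtain ⟨x₀, hx₀, hw⟩ := h.exists_snd_eq_zero hMN hρ₀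
    refine (ENNReal.pow_le_pow_left_iff two_ne_zero).1 ?_
    rw [mul_pow, eLpNorm_two_sq, eLpNorm_two_sq, ← ENNReal.ofReal_pow (inv_nonneg.2 hs.le),
      inv_pow, Real.sq_sqrt hl.le]
    -- The eigenpair estimate is centred at `g x₀`; the mean can only do better.
    refine (lintegral_sub_mean_sq_le hμ0 hg.2 (g x₀)).trans ?_
    rw [hμ, hν, lintegral_withDensity_ofReal hρ, lintegral_withDensity_ofReal hσi]
    exact h.lintegral_sub_sq_le hρ hσ hρ₀ hσ₀ hg.1 hx₀ hw
  obtain ⟨f₁, w₁, h₁, hnorm⟩ := h.exists_normalized hMN hρ hσ hσ₀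
  have hN : eLpNorm w₁ 2 (mu M N a b θ) = 1 := by
    refine (ENNReal.pow_right_strictMono two_ne_zero).injective ?_
    simp only [one_pow]
    rw [eLpNorm_two_sq, hμ, lintegral_withDensity_ofReal hρ, h₁.lintegral_snd_sq hMN hρ hρ₀, hnorm,
      ENNReal.ofReal_one]
  have hE : eLpNorm (deriv w₁) 2 (nu M N a b θ) ^ 2 = ENNReal.ofReal lam := by
    rw [eLpNorm_two_sq, hν, lintegral_withDensity_ofReal hσi,
      h₁.lintegral_deriv_snd_sq hMN hρ hσ hσ₀, hnorm, mul_one]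
  have hadm : Admissible M N a b θ w₁ := by
    refine ⟨fun x y hx hxy hy => h₁.absolutelyContinuousOnInterval_snd hσ hx hxy hy, ?_,
      by rw [hN]; exact ENNReal.one_lt_top⟩
    rw [hμ]
    exact ((h₁.continuousOn_snd.mono Ioo_subset_Icc_self).aestronglyMeasurable
      measurableSet_Ioo).mono_ac (withDensity_absolutelyContinuous _ _)
  have hmean : ∫ y, w₁ y ∂(piMeasure M N a b θ) = 0 := by
    rw [piMeasure, integral_smul_measure, hμ, integral_withDensity_eq_integral_toReal_smul
      hρ.measurable.ennreal_ofReal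
      (Filter.Eventually.of_forall fun _ => ENNReal.ofReal_lt_top)]
    have := h₁.integral_mul_snd_eq_zero hMN hρ
    rw [intervalIntegral.integral_of_le hMN.le, integral_Ioc_eq_integral_Ioo] at this
    simp only [ENNReal.toReal_ofReal (hρ₀ _).le, smul_eq_mul, this, mul_zero]
  have hinv : ENNReal.ofReal (√lam)⁻¹ ^ 2 * ENNReal.ofReal lam = 1 := by
    rw [← ENNReal.ofReal_pow (inv_nonneg.2 hs.le), inv_pow, Real.sq_sqrt hl.le,
      ← ENNReal.ofReal_mul (inv_nonneg.2 hl.le), inv_mul_cancel₀ hl.ne', ENNReal.ofReal_one]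
  constructor
  · refine le_antisymm (sInf_le poincare) (le_sInf fun A hA => ?_)
    have hA' := hA w₁ hadm
    simp only [hmean, sub_zero] at hA'
    rw [show (fun x => w₁ x) = w₁ from rfl, hN] at hA'
    -- The extremal `w₁` has norm `1` and energy `λ`, so every admissible constant satisfies `A² λ ≥
    -- 1`.
    have hA2 : 1 ≤ A ^ 2 * ENNReal.ofReal lam := by
      rw [← hE, ← mul_pow]
      exact one_le_pow₀ hA'
    refine (ENNReal.pow_le_pow_left_iff two_ne_zero).1 ?_
    refine (ENNReal.mul_le_mul_iff_left (ENNReal.ofReal_pos.2 hl).ne' ENNReal.ofReal_ne_top).1 ?_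
    rwa [hinv]
  · refine le_antisymm (sInf_le ⟨w₁, hadm, hmean, hN, hE.symm⟩) (le_sInf ?_)
    rintro r ⟨g, hg, hg0, hgN, rfl⟩
    have hP := poincare g hg
    simp only [hg0, sub_zero] at hP
    rw [show (fun x => g x) = g from rfl, hgN] at hP
    have hP2 := pow_le_pow_left' hP 2
    rw [one_pow, mul_pow, ← hinv] at hP2
    exact (ENNReal.mul_le_mul_iff_right
      (pow_ne_zero 2 (ENNReal.ofReal_pos.2 (inv_pos.2 hs)).ne')
      (ENNReal.pow_ne_top ENNReal.ofReal_ne_top)).1 hP2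

/-! ### Regularity, and the principal eigenvalue of the dual operator -/

theorem contDiffOn_one_Icc_of_hasDerivWithinAt {p q : ℝ} (hpq : p < q) {f f' : ℝ → ℝ}
    (hf : ∀ x ∈ Icc p q, HasDerivWithinAt f (f' x) (Icc p q) x) (hf' : ContinuousOn f' (Icc p q)) :
    ContDiffOn ℝ 1 f (Icc p q) := by
  have hu := uniqueDiffOn_Icc hpq
  rw [show (1 : WithTop ℕ∞) = 0 + 1 by norm_num, contDiffOn_succ_iff_derivWithin hu]
  refine ⟨fun x hx => (hf x hx).differentiableWithinAt, by simp, ?_⟩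
  rw [contDiffOn_zero]
  exact hf'.congr fun x hx => (hf x hx).derivWithin (hu x hx)

theorem contDiffOn_two_Ioo_of_hasDerivAt {p q : ℝ} {f f' : ℝ → ℝ}
    (hf : ∀ x ∈ Ioo p q, HasDerivAt f (f' x) x) (hf' : ContDiffOn ℝ 1 f' (Ioo p q)) :
    ContDiffOn ℝ 2 f (Ioo p q) := by
  rw [show (2 : WithTop ℕ∞) = 1 + 1 by norm_num, contDiffOn_succ_iff_deriv_of_isOpen isOpen_Ioo]
  refine ⟨fun x hx => (hf x hx).differentiableAt.differentiableWithinAt, by simp, ?_⟩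
  exact hf'.congr fun x hx => (hf x hx).deriv

theorem hasDerivAt_deriv_of_contDiffOn_two {p q : ℝ} {f : ℝ → ℝ} (hf : ContDiffOn ℝ 2 f (Ioo p q))
    {x : ℝ} (hx : x ∈ Ioo p q) :
    HasDerivAt f (deriv f x) x ∧ HasDerivAt (deriv f) (deriv (deriv f) x) x := by
  have hn : Ioo p q ∈ nhds x := isOpen_Ioo.mem_nhds hx
  refine ⟨((hf.contDiffAt hn).differentiableAt (by norm_num)).hasDerivAt, ?_⟩
  have h1 : ContDiffOn ℝ 1 (deriv f) (Ioo p q) :=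
    hf.deriv_of_isOpen isOpen_Ioo (by norm_num)
  exact ((h1.contDiffAt hn).differentiableAt (by norm_num)).hasDerivAt

theorem hasDerivAt_of_contDiffOn_one {p q : ℝ} {f : ℝ → ℝ} (hf : ContDiffOn ℝ 1 f (Ioo p q))
    {x : ℝ} (hx : x ∈ Ioo p q) : HasDerivAt f (deriv f x) x :=
  ((hf.contDiffAt (isOpen_Ioo.mem_nhds hx)).differentiableAt (by norm_num)).hasDerivAt

/-- The Dirichlet eigenvalue is the principal eigenvalue of the dual operator. -/
theorem lambdaDual_eq {M N θ : ℝ} (hMN : -M < N) {a b ρ σ : ℝ → ℝ}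
    (hρ : Continuous ρ) (hσ : Continuous σ) (hρ₀ : ∀ x, 0 < ρ x) (hσ₀ : ∀ x, 0 < σ x)
    (hμeq : EqOn (muDensity a b θ) ρ (Icc (-M) N))
    (hνeq : EqOn (nuHatDensity a b θ) σ (Icc (-M) N))
    (hρd : ContDiffOn ℝ 1 ρ (Ioo (-M) N))
    {lam : ℝ} {f w : ℝ → ℝ} (h : IsDirichletEigenpair (-M) N ρ σ lam f w) :
    lambdaDual M N a b θ = (lam : EReal) := by
  have hop : ∀ (g : ℝ → ℝ), ∀ x ∈ Ioo (-M) N,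
      opDual a b θ g x = deriv (fun y => deriv g y / ρ y) x / σ x := by
    intro g x hx
    simp only [opDual, derivWrt]
    rw [hνeq (Ioo_subset_Icc_self hx)]
    congr 1
    refine Filter.EventuallyEq.deriv_eq ?_
    filter_upwards [isOpen_Ioo.mem_nhds hx] with y hy
    rw [derivWrt, hμeq (Ioo_subset_Icc_self hy)]
  have hwd : ∀ x ∈ Ioo (-M) N, HasDerivAt w (-(lam * σ x * f x)) x := fun x hx =>
    h.hasDerivAt_snd x (Ioo_subset_Icc_self hx)
  refine le_antisymm (iSup₂_le fun g hg => ?_) ?_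
  · obtain ⟨hg1, hg2, hgp, hgq, hgpos⟩ := hg
    have hu := uniqueDiffOn_Icc hMN
    have hg' : ContinuousOn (derivWithin g (Icc (-M) N)) (Icc (-M) N) :=
      hg1.continuousOn_derivWithin hu le_rfl
    -- The Wronskian of `f` and `g` relative to `ρ`, as `w = f'/ρ`. The one-sided `derivWithin`
    -- keeps it continuous up to the endpoints, where it vanishes with `f` and `g`.
    set W : ℝ → ℝ := fun x => f x * (derivWithin g (Icc (-M) N) x / ρ x) - g x * w x
    have hWc : ContinuousOn W (Icc (-M) N) :=
      (h.continuousOn_fst.mul (hg'.div hρ.continuousOn fun x _ => (hρ₀ x).ne')).sub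
        (hg1.continuousOn.mul h.continuousOn_snd)
    have hWd : ∀ x ∈ Ioo (-M) N,
        HasDerivAt W (σ x * f x * (opDual a b θ g x + lam * g x)) x := by
      intro x hx
      obtain ⟨hgd, hgdd⟩ := hasDerivAt_deriv_of_contDiffOn_two hg2 hx
      have hquot : DifferentiableAt ℝ (fun y => deriv g y / ρ y) x :=
        hgdd.differentiableAt.div (hasDerivAt_of_contDiffOn_one hρd hx).differentiableAt
          (hρ₀ x).ne'
      have hWeq : W =ᶠ[nhds x] fun y => f y * (deriv g y / ρ y) - g y * w y := by
        filter_upwards [isOpen_Ioo.mem_nhds hx] with y hy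
        simp only [W]
        rw [derivWithin_of_mem_nhds (Icc_mem_nhds hy.1 hy.2)]
      refine HasDerivAt.congr_of_eventuallyEq ?_ hWeq
      refine (((h.hasDerivAt_fst x (Ioo_subset_Icc_self hx)).mul hquot.hasDerivAt).sub
        (hgd.mul (hwd x hx))).congr_deriv ?_
      rw [hop g x hx]
      have h1 := (hρ₀ x).ne'
      have h2 := (hσ₀ x).ne'
      field_simp
      ring
    -- At a critical point of `W` the quotient `-L* g / g` equals `λ`, so its infimum is at most
    -- `λ`.
    obtain ⟨c, hc, hc0⟩ := exists_hasDerivAt_eq_zero hMN hWc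
      (by simp [W, h.left_eq_zero, h.right_eq_zero, hgp, hgq]) hWd
    have hfc := h.pos c hc
    have hsum : opDual a b θ g c + lam * g c = 0 :=
      (mul_eq_zero.1 hc0).resolve_left (mul_pos (hσ₀ c) hfc).ne'
    refine iInf₂_le_of_le c hc (EReal.coe_le_coe_iff.2 (le_of_eq ?_))
    rw [div_eq_iff (hgpos c hc).ne']
    linarith
  -- The supremum is attained at `f`, whose quotient is `λ` everywhere.
  · have hfd : ∀ x ∈ Ioo (-M) N, HasDerivAt f (ρ x * w x) x := fun x hx =>
      h.hasDerivAt_fst x (Ioo_subset_Icc_self hx)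
    have hw1 : ContDiffOn ℝ 1 w (Icc (-M) N) :=
      contDiffOn_one_Icc_of_hasDerivWithinAt hMN
        (fun x hx => (h.hasDerivAt_snd x hx).hasDerivWithinAt)
        ((continuousOn_const.mul hσ.continuousOn).mul h.continuousOn_fst).neg
    have hfmem : f ∈ testClass M N :=
      ⟨contDiffOn_one_Icc_of_hasDerivWithinAt hMN
        (fun x hx => (h.hasDerivAt_fst x hx).hasDerivWithinAt)
        (hρ.continuousOn.mul h.continuousOn_snd),
      contDiffOn_two_Ioo_of_hasDerivAt hfd (hρd.mul (hw1.mono Ioo_subset_Icc_self)),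
      h.left_eq_zero, h.right_eq_zero, h.pos⟩
    refine le_iSup₂_of_le f hfmem (le_iInf₂ fun x hx => EReal.coe_le_coe_iff.2 (le_of_eq ?_))
    have hev : (fun y => deriv f y / ρ y) =ᶠ[nhds x] w := by
      filter_upwards [isOpen_Ioo.mem_nhds hx] with y hy
      rw [(hfd y hy).deriv, mul_div_cancel_left₀ _ (hρ₀ y).ne']
    rw [hop f x hx, hev.deriv_eq, (hwd x hx).deriv]
    have h1 := (h.pos x hx).ne'
    have h2 := (hσ₀ x).ne'
    field_simp

/-! ### Conjugation of the Schrödinger operator to the dual operator -/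

theorem principalEigenvalue_le_of_map {M N : ℝ} {T T' : (ℝ → ℝ) → ℝ → ℝ} {Φ : (ℝ → ℝ) → ℝ → ℝ}
    (hΦ : ∀ f ∈ testClass M N, Φ f ∈ testClass M N)
    (hT : ∀ f ∈ testClass M N, ∀ x ∈ Ioo (-M) N, -T f x / f x = -T' (Φ f) x / Φ f x) :
    principalEigenvalue M N T ≤ principalEigenvalue M N T' := by
  refine iSup₂_le fun f hf => le_iSup₂_of_le (Φ f) (hΦ f hf) (le_iInf₂ fun x hx => ?_)
  rw [← hT f hf x hx]
  exact iInf₂_le x hx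

theorem exp_mul_mem_testClass {M N : ℝ} {c f : ℝ → ℝ} (hc : ContDiffOn ℝ 1 c (Icc (-M) N))
    (hc2 : ContDiffOn ℝ 2 c (Ioo (-M) N)) (hf : f ∈ testClass M N) :
    (fun x => Real.exp (c x) * f x) ∈ testClass M N := by
  obtain ⟨h1, h2, h3, h4, h5⟩ := hf
  exact ⟨hc.exp.mul h1, hc2.exp.mul h2, by simp [h3], by simp [h4],
    fun x hx => mul_pos (Real.exp_pos _) (h5 x hx)⟩

/-- The intertwining `L* (e^C f) = e^C L_S f`. -/
theorem opDual_exp_mul {p q θ : ℝ} {a b f : ℝ → ℝ} (ha : ContDiffOn ℝ 1 a (Ioo p q))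
    (hb : ContDiffOn ℝ 1 b (Ioo p q)) (hpos : ∀ x ∈ Ioo p q, 0 < a x)
    (hC : ∀ x ∈ Ioo p q, HasDerivAt (potential a b θ) (b x / a x) x)
    (hf : ContDiffOn ℝ 2 f (Ioo p q)) {x : ℝ} (hx : x ∈ Ioo p q) :
    opDual a b θ (fun y => Real.exp (potential a b θ y) * f y) x =
      Real.exp (potential a b θ x) * opLS a b f x := by
  -- Since `a C' = b`, the exponential cancels in the inner derivative; differentiating `a f' + b f`
  -- then gives `L_S f`.
  have hev : derivWrt (muDensity a b θ) (fun y => Real.exp (potential a b θ y) * f y) =ᶠ[nhds x]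
      fun y => a y * deriv f y + b y * f y := by
    filter_upwards [isOpen_Ioo.mem_nhds hx] with y hy
    have hd := ((hC y hy).exp.mul (hasDerivAt_deriv_of_contDiffOn_two hf hy).1).deriv
    simp only [derivWrt, muDensity]
    erw [hd]
    have := (hpos y hy).ne'
    have := (Real.exp_pos (potential a b θ y)).ne'
    field_simp
    ring
  obtain ⟨hfd, hfdd⟩ := hasDerivAt_deriv_of_contDiffOn_two hf hx
  have hd := (((hasDerivAt_of_contDiffOn_one ha hx).mul hfdd).add
    ((hasDerivAt_of_contDiffOn_one hb hx).mul hfd)).deriv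
  rw [opDual, derivWrt, hev.deriv_eq]
  erw [hd]
  simp only [nuHatDensity, opLS, Real.exp_neg, div_inv_eq_mul]
  ring

/-- The Schrödinger operator and the dual operator have the same principal eigenvalue. -/
theorem lambdaS_eq_lambdaDual {M N θ : ℝ} {a b C : ℝ → ℝ}
    (ha : ContDiffOn ℝ 1 a (Ioo (-M) N)) (hb : ContDiffOn ℝ 1 b (Ioo (-M) N))
    (hpos : ∀ x ∈ Ioo (-M) N, 0 < a x) (hC : ContDiff ℝ 1 C)
    (hCeq : EqOn (potential a b θ) C (Icc (-M) N))
    (hCd : ∀ x ∈ Icc (-M) N, HasDerivAt C (b x / a x) x) :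
    lambdaS M N a b = lambdaDual M N a b θ := by
  have hP1 : ContDiffOn ℝ 1 (potential a b θ) (Icc (-M) N) := hC.contDiffOn.congr hCeq
  have hPd : ∀ x ∈ Ioo (-M) N, HasDerivAt (potential a b θ) (b x / a x) x := fun x hx =>
    (hCd x (Ioo_subset_Icc_self hx)).congr_of_eventuallyEq
      (hCeq.eventuallyEq_of_mem (Icc_mem_nhds hx.1 hx.2))
  -- `C' = b/a` is `C¹` inside, so multiplication by `e^C` or `e^{-C}` preserves the test class.
  have hP2 : ContDiffOn ℝ 2 (potential a b θ) (Ioo (-M) N) :=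
    contDiffOn_two_Ioo_of_hasDerivAt hPd (hb.div ha fun x hx => (hpos x hx).ne')
  refine le_antisymm
    (principalEigenvalue_le_of_map (Φ := fun f x => Real.exp (potential a b θ x) * f x)
      (fun f hf => exp_mul_mem_testClass hP1 hP2 hf) fun f hf x hx => ?_)
    (principalEigenvalue_le_of_map (Φ := fun f x => Real.exp (-potential a b θ x) * f x)
      (fun f hf => exp_mul_mem_testClass hP1.neg hP2.neg hf) fun f hf x hx => ?_)
  · rw [opDual_exp_mul ha hb hpos hPd hf.2.1 hx, ← mul_neg,
      mul_div_mul_left _ _ (Real.exp_pos _).ne']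
  · have hg : (fun x => Real.exp (-potential a b θ x) * f x) ∈ testClass M N :=
      exp_mul_mem_testClass hP1.neg hP2.neg hf
    have hfe : f = fun y => Real.exp (potential a b θ y) *
        (Real.exp (-potential a b θ y) * f y) := by
      funext y
      rw [← mul_assoc, ← Real.exp_add, add_neg_cancel, Real.exp_zero, one_mul]
    have he := opDual_exp_mul ha hb hpos hPd hg.2.1 hx
    rw [← hfe] at he
    rw [he, ← mul_neg, ← mul_div_mul_left (-opLS a b _ x) _ (Real.exp_pos (potential a b θ x)).ne']
    congr 1
    exact congrFun hfe x

end HardyLinear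

theorem proposition1p2 (M N θ : ℝ) (hMN : -M < N) (hθ : θ ∈ Set.Ioo (-M) N) (a b : ℝ → ℝ)
    (ha : ContinuousOn a (Set.Icc (-M) N)) (hb : ContinuousOn b (Set.Icc (-M) N))
    (hpos : ∀ x ∈ Set.Icc (-M) N, 0 < a x) :
    0 < HardyLinear.optimalConst M N a b θ ∧
    HardyLinear.optimalConst M N a b θ < ⊤ ∧
    (HardyLinear.optimalConst M N a b θ ^ 2)⁻¹ = HardyLinear.lambdaOne M N a b θ ∧
    (ContDiffOn ℝ 1 a (Set.Ioo (-M) N) → ContDiffOn ℝ 1 b (Set.Ioo (-M) N) →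
      (HardyLinear.lambdaOne M N a b θ : EReal) = HardyLinear.lambdaS M N a b) ∧
    (ContDiffOn ℝ 1 a (Set.Ioo (-M) N) →
      (HardyLinear.lambdaOne M N a b θ : EReal) = HardyLinear.lambdaDual M N a b θ) := by
  obtain ⟨C, hC, hCeq, hCd⟩ := HardyLinear.exists_contDiff_eqOn_potential hMN hθ ha hb hpos
  obtain ⟨ρ, σ, hρ, hσ, hρ₀, hσ₀, hμeq, hνhat, hνeq⟩ :=
    HardyLinear.exists_density_extension hMN hθ ha hb hpos
  obtain ⟨lam, f, w, hl, hf, hw, hf0, hf1, hfpos⟩ :=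
    HardyLinear.exists_dirichlet_eigenpair hMN hρ hσ hρ₀ hσ₀
  have h : HardyLinear.IsDirichletEigenpair (-M) N ρ σ lam f w := ⟨hl, hf, hw, hf0, hf1, hfpos⟩
  obtain ⟨hA, hlam⟩ :=
    HardyLinear.optimalConst_eq_and_lambdaOne_eq hMN hρ hσ hρ₀ hσ₀ hμeq hνeq h
  have hs : 0 < √lam := Real.sqrt_pos.2 hl
  have hdual : ContDiffOn ℝ 1 a (Set.Ioo (-M) N) →
      (HardyLinear.lambdaOne M N a b θ : EReal) = HardyLinear.lambdaDual M N a b θ := by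
    intro ha1
    -- `C` is `C¹` for merely continuous `a` and `b`, so `C¹` regularity of `a` alone makes `ρ = e^C
    -- / a` differentiable enough for `f` to be `C²`.
    have hρd : ContDiffOn ℝ 1 ρ (Ioo (-M) N) := by
      refine (hC.exp.contDiffOn.div ha1
        fun x hx => (hpos x (Ioo_subset_Icc_self hx)).ne').congr fun x hx => ?_
      rw [← hμeq (Ioo_subset_Icc_self hx), HardyLinear.muDensity, hCeq (Ioo_subset_Icc_self hx),
        Pi.div_apply]
    rw [HardyLinear.lambdaDual_eq hMN hρ hσ hρ₀ hσ₀ hμeq hνhat hρd h, hlam,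
      EReal.coe_ennreal_ofReal, max_eq_left hl.le]
  refine ⟨?_, ?_, ?_, fun ha1 hb1 => ?_, hdual⟩
  · rw [hA]
    exact ENNReal.ofReal_pos.2 (inv_pos.2 hs)
  · rw [hA]
    exact ENNReal.ofReal_lt_top
  · rw [hA, hlam, ← ENNReal.ofReal_pow (inv_nonneg.2 hs.le), inv_pow, Real.sq_sqrt hl.le,
      ← ENNReal.ofReal_inv_of_pos (inv_pos.2 hl), inv_inv]
  · rw [hdual ha1, HardyLinear.lambdaS_eq_lambdaDual ha1 hb1
      (fun x hx => hpos x (Ioo_subset_Icc_self hx)) hC hCeq hCd]
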